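/- Let $-\infty<a<b<\infty$, write $(\cdot,\cdot)$ and $\|\cdot\|$ for the inner product and norm of the real space $L^2=L^2(a,b)$, let $B$ be its closed unit ball, and let $\partial$ be the weak derivative. Let $K f(x)=\int_a^b K(x,y)f(y)\,dy$ be an integral operator on $L^2$ with square-integrable kernel on $(a,b)^2$ (for example a bounded piecewise continuous one), and $K^*$ its adjoint. Put $$A^0=\{u\in B: u\perp\ker K^*\},\quad A^0_*=\{u\in B: u\perp\ker K\},\quad A=A^1=K(B),\quad A_*=A^1_*=K^*(B),$$ and $A^r=K(A^{r-1}_*)$, $A^r_*=K^*(A^{r-1})$ for $r\ge 2$. Assume that $\partial K f=f$ for all $f\in A^r_*$ and $\partial K^*g=-g$ for all $g\in A^r$, for every $r\ge 0$. For $A'\subset L^2$ and a finite-dimensional subspace $\mathbb X\subset L^2$ with $L^2$-projector $X$ let $E(A',\mathbb X)=\sup_{u\in A'}\|u-Xu\|$, and let $d_n(A')=\inf_{\dim \mathbb X=n}E(A',\mathbb X)$ be the Kolmogorov $n$-width; $\mathbb X$ is optimal for the $n$-width of $A'$ if $\dim\mathbb X\le n$ and $E(A',\mathbb X)=d_n(A')$.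 Let $\mathbb X_0\perp\ker K^*$ and $\mathbb Y_0\perp\ker K$ be subspaces of $L^2$ such that $\mathbb X_0$ is optimal for the $n$-width of $A$ and $\mathbb Y_0$ is optimal for the $n$-width of $A_*$, and put $\mathbb X_p=K(\mathbb Y_{p-1})$, $\mathbb Y_p=K^*(\mathbb X_{p-1})$ for $p\ge1$. Let $\mu_1\le\mu_2\le\cdots$ be the eigenvalues, in increasing order and counted with multiplicity, of the problem: find $0\neq\psi\in K(L^2)$ and $\mu\in\mathbb R$ with $$(\partial\psi,\partial v)=\mu(\psi,v)\quad\text{for all } v\in K(L^2).$$ Assume that there are at least $n+1$ of them (the non-trivial case, in which the $(n+1)$-st largest eigenvalue $\lambda_{n+1}=1/\mu_{n+1}$ of $K^*K$ is positive) and that $\mu_1\le\dots\le\mu_n<\mu_{n+1}$. Let $\mu_{p,l}$ be the $l$-th eigenvalue, ordered and counted in the same way, of the discretized problem: find $0\ne\psi_p\in\mathbb X_p$ and $\mu_p\in\mathbb R$ with $(\partial\psi_p,\partial v)=\mu_p(\psi_p,v)$ for all $v\in\mathbb X_p$. Then, for every $l\in\{1,\dots,n\}$ and every $p\ge0$ such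 that $$\sqrt l\,\frac{\mu_l}{\mu_1}\Bigl(\frac{\mu_l}{\mu_{n+1}}\Bigr)^{p}<\frac12,$$ the eigenvalue $\mu_{p,l}$ exists and $$\mu_l\le\mu_{p,l}\le\frac{\mu_l}{1-2\sqrt l\,\frac{\mu_l}{\mu_1}\bigl(\frac{\mu_l}{\mu_{n+1}}\bigr)^{p}}.$$ -/

import Mathlib

open MeasureTheory Set
open scoped ENNReal ContDiff

noncomputable section

/-- Lebesgue measure on the interval `(a, b)`. -/
abbrev intervalMeasure (a b : ℝ) : Measure ℝ := volume.restrict (Ioo a b)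

/-- The real Hilbert space `L²(a, b)`. -/
abbrev L2 (a b : ℝ) : Type := Lp ℝ 2 (intervalMeasure a b)

/-- A kernel that is square-integrable on `(a, b) × (a, b)`. -/
def SquareIntegrableKernel (a b : ℝ) (k : ℝ → ℝ → ℝ) : Prop :=
  MemLp (Function.uncurry k) 2 ((intervalMeasure a b).prod (intervalMeasure a b))

/-- The function `x ↦ ∫_a^b k(x, y) f(y) dy`. -/
def kernelIntegral (a b : ℝ) (k : ℝ → ℝ → ℝ) (f : ℝ → ℝ) : ℝ → ℝ :=
  fun x => ∫ y, k x y * f y ∂(intervalMeasure a b)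

section IntegralOperator

variable {a b : ℝ} {k : ℝ → ℝ → ℝ}

theorem integrable_kernel_mul (hk : SquareIntegrableKernel a b k) {f : ℝ → ℝ}
    (hf : MemLp f 2 (intervalMeasure a b)) :
    Integrable (fun z : ℝ × ℝ => k z.1 z.2 * f z.2)
      ((intervalMeasure a b).prod (intervalMeasure a b)) :=
  MemLp.integrable_mul hk (hf.comp_snd (intervalMeasure a b))

theorem ae_integrable_kernel_mul (hk : SquareIntegrableKernel a b k) {f : ℝ → ℝ}
    (hf : MemLp f 2 (intervalMeasure a b)) :
    ∀ᵐ x ∂(intervalMeasure a b), Integrable (fun y => k x y * f y) (intervalMeasure a b) :=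
  (integrable_kernel_mul hk hf).prod_right_ae

theorem aestronglyMeasurable_kernelIntegral (hk : SquareIntegrableKernel a b k) {f : ℝ → ℝ}
    (hf : MemLp f 2 (intervalMeasure a b)) :
    AEStronglyMeasurable (kernelIntegral a b k f) (intervalMeasure a b) :=
  (integrable_kernel_mul hk hf).1.integral_prod_right'

theorem eLpNorm_two_sq {α : Type*} [MeasurableSpace α] (μ : Measure α) (g : α → ℝ) :
    eLpNorm g 2 μ ^ 2 = ∫⁻ x, ‖g x‖ₑ ^ 2 ∂μ := by
  have h := eLpNorm_nnreal_pow_eq_lintegral (f := g) (μ := μ) (p := 2) two_ne_zero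
  simpa using h

theorem eLpNorm_kernelIntegral_le (hk : SquareIntegrableKernel a b k) {f : ℝ → ℝ}
    (hf : MemLp f 2 (intervalMeasure a b)) :
    eLpNorm (kernelIntegral a b k f) 2 (intervalMeasure a b) ≤
      eLpNorm (Function.uncurry k) 2 ((intervalMeasure a b).prod (intervalMeasure a b)) *
        eLpNorm f 2 (intervalMeasure a b) := by
  have key : ∀ᵐ x ∂(intervalMeasure a b), ‖kernelIntegral a b k f x‖ₑ ^ 2 ≤
      (∫⁻ y, ‖k x y‖ₑ ^ 2 ∂(intervalMeasure a b)) * eLpNorm f 2 (intervalMeasure a b) ^ 2 := by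
    filter_upwards [hk.1.prodMk_left] with x hx
    have h1 : ‖kernelIntegral a b k f x‖ₑ ≤
        eLpNorm (fun y => k x y) 2 (intervalMeasure a b) *
          eLpNorm f 2 (intervalMeasure a b) := by
      calc ‖kernelIntegral a b k f x‖ₑ
          ≤ ∫⁻ y, ‖k x y * f y‖ₑ ∂(intervalMeasure a b) := enorm_integral_le_lintegral_enorm _
        _ = eLpNorm ((fun y => k x y) • f) 1 (intervalMeasure a b) := by
            rw [eLpNorm_one_eq_lintegral_enorm]; rfl
        _ ≤ _ := eLpNorm_smul_le_mul_eLpNorm hf.1 hx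
    rw [← eLpNorm_two_sq, ← mul_pow]
    exact pow_le_pow_left' h1 2
  have hsq : eLpNorm (kernelIntegral a b k f) 2 (intervalMeasure a b) ^ 2 ≤
      (eLpNorm (Function.uncurry k) 2 ((intervalMeasure a b).prod (intervalMeasure a b)) *
        eLpNorm f 2 (intervalMeasure a b)) ^ 2 := by
    rw [mul_pow, eLpNorm_two_sq, eLpNorm_two_sq _ (Function.uncurry k),
      lintegral_prod _ (hk.1.enorm.pow_const 2),
      ← lintegral_mul_const' _ _ (ENNReal.pow_ne_top hf.2.ne)]
    exact lintegral_mono_ae key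
  exact (ENNReal.pow_le_pow_left_iff two_ne_zero).1 hsq

theorem memLp_kernelIntegral (hk : SquareIntegrableKernel a b k) {f : ℝ → ℝ}
    (hf : MemLp f 2 (intervalMeasure a b)) :
    MemLp (kernelIntegral a b k f) 2 (intervalMeasure a b) :=
  ⟨aestronglyMeasurable_kernelIntegral hk hf,
    (eLpNorm_kernelIntegral_le hk hf).trans_lt (ENNReal.mul_lt_top hk.2 hf.2)⟩

/-- The linear map underlying the integral operator. -/
def integralLinearMap (hk : SquareIntegrableKernel a b k) : L2 a b →ₗ[ℝ] L2 a b where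
  toFun f := (memLp_kernelIntegral hk (Lp.memLp f)).toLp (kernelIntegral a b k f)
  map_add' f g := by
    rw [← MemLp.toLp_add, MemLp.toLp_eq_toLp_iff]
    filter_upwards [ae_integrable_kernel_mul hk (Lp.memLp f),
      ae_integrable_kernel_mul hk (Lp.memLp g)] with x hf hg
    simp only [kernelIntegral, Pi.add_apply]
    rw [← integral_add hf hg]
    refine integral_congr_ae ?_
    filter_upwards [Lp.coeFn_add f g] with y hy
    rw [hy, Pi.add_apply, mul_add]
  map_smul' c f := by
    rw [RingHom.id_apply, ← MemLp.toLp_const_smul, MemLp.toLp_eq_toLp_iff]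
    refine Filter.Eventually.of_forall fun x => ?_
    simp only [kernelIntegral, Pi.smul_apply, smul_eq_mul]
    rw [← integral_const_mul]
    refine integral_congr_ae ?_
    filter_upwards [Lp.coeFn_smul c f] with y hy
    rw [hy, Pi.smul_apply, smul_eq_mul, mul_left_comm]

theorem norm_integralLinearMap_le (hk : SquareIntegrableKernel a b k) (f : L2 a b) :
    ‖integralLinearMap hk f‖ ≤ (eLpNorm (Function.uncurry k) 2
      ((intervalMeasure a b).prod (intervalMeasure a b))).toReal * ‖f‖ := by
  have h : ‖integralLinearMap hk f‖ =
      (eLpNorm (kernelIntegral a b k f) 2 (intervalMeasure a b)).toReal :=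
    Lp.norm_toLp _ (memLp_kernelIntegral hk (Lp.memLp f))
  rw [h, Lp.norm_def, ← ENNReal.toReal_mul]
  exact ENNReal.toReal_mono (ENNReal.mul_lt_top hk.2 (Lp.memLp f).2).ne
    (eLpNorm_kernelIntegral_le hk (Lp.memLp f))

/-- The integral operator `K f(x) = ∫_a^b k(x, y) f(y) dy` on `L²(a, b)`. -/
def integralOperator (hk : SquareIntegrableKernel a b k) : L2 a b →L[ℝ] L2 a b :=
  (integralLinearMap hk).mkContinuous _ (norm_integralLinearMap_le hk)

theorem coeFn_integralOperator (hk : SquareIntegrableKernel a b k) (f : L2 a b) :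
    integralOperator hk f =ᵐ[intervalMeasure a b]
      fun x => ∫ y, k x y * f y ∂(intervalMeasure a b) :=
  MemLp.coeFn_toLp (memLp_kernelIntegral hk (Lp.memLp f))

end IntegralOperator

/-- `g ∈ L²(a, b)` is the weak derivative of `u ∈ L²(a, b)`. -/
def HasWeakDeriv {a b : ℝ} (u g : L2 a b) : Prop :=
  ∀ φ : ℝ → ℝ, ContDiff ℝ ∞ φ → HasCompactSupport φ → tsupport φ ⊆ Ioo a b →
    ∫ x, u x * deriv φ x ∂(intervalMeasure a b) = -∫ x, g x * φ x ∂(intervalMeasure a b)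

section Widths

variable {H : Type*} [NormedAddCommGroup H] [InnerProductSpace ℝ H]

/-- The distance `E(A, X) = sup_{u ∈ A} ‖u - P_X u‖`, with `P_X` the orthogonal projector. -/
def distToSubspace (A : Set H) (X : Submodule ℝ H) [X.HasOrthogonalProjection] : ℝ≥0∞ :=
  ⨆ u ∈ A, ‖u - X.starProjection u‖ₑ

/-- The Kolmogorov `n`-width `d_n(A)`. -/
def kolmogorovWidth (n : ℕ) (A : Set H) : ℝ≥0∞ :=
  ⨅ (X : Submodule ℝ H) (_ : FiniteDimensional ℝ X) (_ : Module.finrank ℝ X = n),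
    distToSubspace A X

/-- `X` is an optimal subspace for `d_n(A)`. -/
def IsOptimalSubspace (n : ℕ) (A : Set H) (X : Submodule ℝ H) : Prop :=
  ∃ _ : FiniteDimensional ℝ X,
    Module.finrank ℝ X ≤ n ∧ kolmogorovWidth n A = distToSubspace A X

variable [CompleteSpace H]

/-- The pair of function classes `(A^r, A_*^r)`. Here `B` is the closed unit ball,
`A^0 = B ∩ (ker K*)^⊥`, `A_*^0 = B ∩ (ker K)^⊥`, `A^1 = K(B)`, `A_*^1 = K*(B)`, and
`A^{r+1} = K(A_*^r)`, `A_*^{r+1} = K*(A^r)` for `r ≥ 1`. -/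
def functionClasses (K : H →L[ℝ] H) : ℕ → Set H × Set H
  | 0 => ({u | u ∈ Metric.closedBall (0 : H) 1 ∧ ∀ v, K.adjoint v = 0 → inner ℝ u v = 0},
      {u | u ∈ Metric.closedBall (0 : H) 1 ∧ ∀ v, K v = 0 → inner ℝ u v = 0})
  | 1 => (K '' Metric.closedBall 0 1, K.adjoint '' Metric.closedBall 0 1)
  | r + 2 => (K '' (functionClasses K (r + 1)).2, K.adjoint '' (functionClasses K (r + 1)).1)

/-- The class `A^r`. -/
def classA (K : H →L[ℝ] H) (r : ℕ) : Set H := (functionClasses K r).1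

/-- The class `A_*^r`. -/
def classAStar (K : H →L[ℝ] H) (r : ℕ) : Set H := (functionClasses K r).2

/-- The pair of subspaces `(X_p, Y_p)`, with `X_p = K(Y_{p-1})` and `Y_p = K*(X_{p-1})`. -/
def subspacePair (K : H →L[ℝ] H) (X₀ Y₀ : Submodule ℝ H) : ℕ → Submodule ℝ H × Submodule ℝ H
  | 0 => (X₀, Y₀)
  | p + 1 => ((subspacePair K X₀ Y₀ p).2.map K.toLinearMap,
      (subspacePair K X₀ Y₀ p).1.map K.adjoint.toLinearMap)

/-- The subspace `X_p`. -/
def subspaceX (K : H →L[ℝ] H) (X₀ Y₀ : Submodule ℝ H) (p : ℕ) : Submodule ℝ H :=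
  (subspacePair K X₀ Y₀ p).1

end Widths

/-- `∂K = I` on `A_*^r` and `∂K* = -I` on `A^r` for all `r ≥ 0`, where `∂` is the weak
derivative. -/
def DerivInvertsOperator {a b : ℝ} (K : L2 a b →L[ℝ] L2 a b) : Prop :=
  ∀ r : ℕ, (∀ f ∈ classAStar K r, HasWeakDeriv (K f) f) ∧
    (∀ g ∈ classA K r, HasWeakDeriv (K.adjoint g) (-g))

/-- `(ψ, μ)` with `ψ ≠ 0` solves `(∂ψ, ∂v) = μ (ψ, v)` for all `v ∈ V`, with `ψ ∈ V`. -/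
def IsEigenpair {a b : ℝ} (V : Submodule ℝ (L2 a b)) (μ : ℝ) (ψ : L2 a b) : Prop :=
  ψ ∈ V ∧ ψ ≠ 0 ∧ ∃ dψ : L2 a b, HasWeakDeriv ψ dψ ∧
    ∀ v ∈ V, ∃ dv : L2 a b, HasWeakDeriv v dv ∧ inner ℝ dψ dv = μ * inner ℝ ψ v

/-- `μ` is the `l`-th smallest eigenvalue (`l = 1, 2, …`, counted with multiplicity) of the
problem `(∂ψ, ∂v) = μ (ψ, v)` for all `v ∈ V`: the eigenfunctions with eigenvalue `< μ` span
a space of dimension `< l`, those with eigenvalue `≤ μ` span one of dimension `≥ l`. -/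
def IsNthEigenvalue {a b : ℝ} (V : Submodule ℝ (L2 a b)) (l : ℕ) (μ : ℝ) : Prop :=
  Module.rank ℝ (Submodule.span ℝ {ψ | ∃ κ < μ, IsEigenpair V κ ψ}) < (l : Cardinal) ∧
    (l : Cardinal) ≤ Module.rank ℝ (Submodule.span ℝ {ψ | ∃ κ ≤ μ, IsEigenpair V κ ψ})

end

/-! Every element of `K(L²)` is `K f` for a unique `f ⊥ ker K`, and `∂K = I` makes `f` its weak
derivative. On `K(Y)` with `Y ⊥ ker K` the eigenproblem is therefore the Ritz problem `(f, g) = μ (K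
f, K g)` for `g ∈ Y`, governed by the quotient `‖f‖² / ‖K f‖²`. The exact problem has `Y = (ker
K)ᗮ`, the discretized one `Y = Y_{p-1}` when `p ≥ 1`. As `K` is Hilbert–Schmidt, hence compact,
min-max is available through `mul_norm_sq_le_of_mem_ritzSpan_Iio_orthogonal`, and the lower bound is
monotonicity in `Y`.

For the upper bound let `P` project onto `Y_{p-1}`, let `G` be the span of the exact Ritz vectors
with eigenvalue at most `μ_l`, and use the trial space `P G`. With `r = f - P f`, `‖K P f‖² ≥ ‖K f‖²
- 2 (K f, K r)` and `(K f, K r) = ((I - P) K* K f, (I - P) f)`: a product of two projection errors,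
which squares the rate. Optimality gives `X₀` and `Y₀` the error constant `d = μ_{n+1}^{-1/2}`. On
`Xᗮ` the operator `K*` is the adjoint of `(I - P_X) K`, so its norm there is at most `d`, and every
application of `K` or `K*` to the subspaces gains a factor `d`. With `‖g‖ ≤ √μ_l ‖K g‖` on `G`, the
relative error on `G` is `(d √μ_l) ^ p`.

The result is `μ_l / (1 - 2 (μ_l / μ_{n+1}) ^ p)`, which implies the stated bound because `√l μ_l /
μ_1 ≥ 1`. The same inequality makes the hypothesis fail at `p = 0`. -/

/-! ### Ritz eigenvalues of a compact operator and their min-max principle. -/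

noncomputable section SpectralTheory

open Module.End

variable {H : Type*} [NormedAddCommGroup H] [InnerProductSpace ℝ H]

/-- Otherwise the orthogonal projection onto `G` would embed `W` into `G`. This is the dimension
count behind each min-max comparison. -/
theorem Submodule.exists_ne_zero_mem_orthogonal_of_rank_lt {G W : Submodule ℝ H} {l : ℕ}
    (hG : Module.rank ℝ G < (l : Cardinal)) (hW : (l : Cardinal) ≤ Module.rank ℝ W) :
    ∃ g ∈ W, g ≠ 0 ∧ g ∈ Gᗮ := by
  have : FiniteDimensional ℝ G :=
    Module.rank_lt_aleph0_iff.1 (hG.trans (Cardinal.natCast_lt_aleph0))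
  by_contra! h
  have hinj : Function.Injective (G.orthogonalProjectionOnto.toLinearMap ∘ₗ W.subtype) := by
    rw [injective_iff_map_eq_zero]
    intro w hw
    by_contra hne
    exact h w w.2 (by simpa using hne) (Submodule.orthogonalProjectionOnto_eq_zero_iff.1 hw)
  exact absurd (hG.trans_le hW) (not_lt.2 (LinearMap.rank_le_of_injective _ hinj))

/-- A compact operator `J` on a Hilbert space attains its norm at an eigenvector of `J* J`. -/
theorem IsCompactOperator.exists_inner_map_map_eq {U F : Type*} [NormedAddCommGroup U]
    [InnerProductSpace ℝ U] [CompleteSpace U] [NormedAddCommGroup F] [InnerProductSpace ℝ F]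
    [CompleteSpace F] {J : U →L[ℝ] F} (hJ : IsCompactOperator J) (h0 : J ≠ 0) :
    ∃ u : U, u ≠ 0 ∧ ∀ v, inner ℝ (J u) (J v) = ‖J‖ ^ 2 * inner ℝ u v := by
  set T : U →L[ℝ] U := J.adjoint ∘L J with hT
  have hTinner (x y : U) : inner ℝ (T x) y = inner ℝ (J x) (J y) := by
    simp [hT, ContinuousLinearMap.adjoint_inner_left]
  have hsymm : T.IsSymmetric := fun x y => by
    change inner ℝ (T x) y = inner ℝ x (T y)
    rw [hTinner, real_inner_comm, real_inner_comm (T y), hTinner]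
  have hcomp : IsCompactOperator T := hJ.clm_comp J.adjoint
  have hnorm : ‖T‖ = ‖J‖ ^ 2 := by rw [hT, J.norm_adjoint_comp_self, sq]
  have hpos : 0 < ‖T‖ := by rw [hnorm]; have := norm_pos_iff.2 h0; positivity
  have hrad := T.spectralRadius_eq_nnnorm hsymm.isSelfAdjoint
  have hne : (spectrum ℝ T).Nonempty := by
    rw [nonempty_iff_ne_empty]
    intro he
    rw [spectralRadius, he] at hrad
    simp only [mem_empty_iff_false, iSup_false, bot_eq_zero', ENNReal.iSup_zero] at hrad
    exact hpos.ne' (by exact_mod_cast congrArg ENNReal.toReal hrad.symm)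
  obtain ⟨s, hs, hsT⟩ := spectrum.exists_nnnorm_eq_spectralRadius_of_nonempty hne
  rw [hrad] at hsT
  have hsT' : ‖s‖ = ‖T‖ := congrArg NNReal.toReal (ENNReal.coe_injective hsT)
  have hs0 : s ≠ 0 := by
    rintro rfl
    rw [← hsT'] at hpos
    simp at hpos
  obtain ⟨u, hu⟩ := ((hcomp.hasEigenvalue_iff_mem_spectrum hs0).2 hs).exists_hasEigenvector
  have hu1 : T u = s • u := hu.apply_eq_smul
  have hu0 := hu.2
  have hinn (v : U) : inner ℝ (J u) (J v) = s * inner ℝ u v := by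
    rw [← hTinner, hu1, real_inner_smul_left]
  -- The spectral radius only gives `|s| = ‖T‖`; testing with `u` itself excludes the negative sign.
  have hs_nonneg : 0 ≤ s := by
    have h1 := hinn u
    rw [real_inner_self_eq_norm_sq, real_inner_self_eq_norm_sq] at h1
    by_contra hlt
    have := norm_pos_iff.2 hu0
    nlinarith [sq_nonneg ‖J u‖, mul_pos this this]
  rw [Real.norm_of_nonneg hs_nonneg, hnorm] at hsT'
  exact ⟨u, hu0, fun v => hsT' ▸ hinn v⟩

/-- The solutions `f ∈ Y` of `⟪f, g⟫ = κ ⟪K f, K g⟫` for all `g ∈ Y`. -/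
def ritzEigenspace (K : H →L[ℝ] H) (Y : Submodule ℝ H) (κ : ℝ) : Submodule ℝ H where
  carrier := {f | f ∈ Y ∧ ∀ g ∈ Y, inner ℝ f g = κ * inner ℝ (K f) (K g)}
  zero_mem' := ⟨Y.zero_mem, by simp⟩
  add_mem' := fun hf hg => ⟨Y.add_mem hf.1 hg.1, fun v hv => by
    rw [map_add, inner_add_left, inner_add_left, hf.2 v hv, hg.2 v hv, mul_add]⟩
  smul_mem' := fun c f hf => ⟨Y.smul_mem c hf.1, fun v hv => by
    rw [map_smul, real_inner_smul_left, real_inner_smul_left, hf.2 v hv, mul_left_comm]⟩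

/-- The span of the solutions of the Ritz problem on `Y` with eigenvalue in `S`. -/
def ritzSpan (K : H →L[ℝ] H) (Y : Submodule ℝ H) (S : Set ℝ) : Submodule ℝ H :=
  ⨆ κ : S, ritzEigenspace K Y κ

variable {K : H →L[ℝ] H} {Y : Submodule ℝ H}

theorem ritzEigenspace_le_ritzSpan {S : Set ℝ} {κ : ℝ} (hκ : κ ∈ S) :
    ritzEigenspace K Y κ ≤ ritzSpan K Y S :=
  le_iSup (fun κ : S => ritzEigenspace K Y κ) ⟨κ, hκ⟩

theorem ritzSpan_le (S : Set ℝ) : ritzSpan K Y S ≤ Y := iSup_le fun _ _ hf => hf.1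

theorem ritzSpan_mono {S S' : Set ℝ} (h : S ⊆ S') : ritzSpan K Y S ≤ ritzSpan K Y S' :=
  iSup_le fun κ => ritzEigenspace_le_ritzSpan (h κ.2)

theorem norm_sq_of_mem_ritzEigenspace {κ : ℝ} {f : H} (hf : f ∈ ritzEigenspace K Y κ) :
    ‖f‖ ^ 2 = κ * ‖K f‖ ^ 2 := by
  rw [← real_inner_self_eq_norm_sq, ← real_inner_self_eq_norm_sq, hf.2 f hf.1]

theorem pos_of_mem_ritzEigenspace {κ : ℝ} {f : H} (hf : f ∈ ritzEigenspace K Y κ) (h0 : f ≠ 0) :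
    0 < κ := by
  have h := norm_sq_of_mem_ritzEigenspace hf
  have := norm_pos_iff.2 h0
  by_contra! hκ
  nlinarith [sq_nonneg ‖K f‖, mul_pos this this]

theorem inner_map_map_eq_zero_of_mem_ritzEigenspace {κ κ' : ℝ} (h : κ ≠ κ') {f g : H}
    (hf : f ∈ ritzEigenspace K Y κ) (hg : g ∈ ritzEigenspace K Y κ') :
    inner ℝ (K f) (K g) = 0 := by
  have h1 := hf.2 g hg.1
  have h2 := hg.2 f hf.1
  rw [real_inner_comm, real_inner_comm (K f)] at h2
  have : (κ - κ') * inner ℝ (K f) (K g) = 0 := by rw [sub_mul, ← h1, ← h2, sub_self]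
  exact (mul_eq_zero.1 this).resolve_left (sub_ne_zero.2 h)

/-- Components for distinct eigenvalues are `K`-orthogonal, so `‖g‖²` and `‖K g‖²` are sums over the
components of `g`, with weights `κ ≤ ν` and `1` on the same terms. -/
theorem norm_sq_le_of_mem_ritzSpan_Iic {ν : ℝ} {g : H} (hg : g ∈ ritzSpan K Y (Iic ν)) :
    ‖g‖ ^ 2 ≤ ν * ‖K g‖ ^ 2 := by
  obtain ⟨f, hf, rfl⟩ := (Submodule.mem_iSup_iff_exists_finsupp _ _).1 hg
  set g := f.sum fun _ x => x
  have hgY : g ∈ Y := ritzSpan_le _ hg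
  have hKg (κ : Iic ν) : inner ℝ (K (f κ)) (K g) = ‖K (f κ)‖ ^ 2 := by
    by_cases hκ : κ ∈ f.support
    · simp only [g, Finsupp.sum, map_sum, inner_sum]
      rw [Finset.sum_eq_single κ, real_inner_self_eq_norm_sq]
      · intro κ' _ hne
        exact inner_map_map_eq_zero_of_mem_ritzEigenspace
          (fun h => hne (Subtype.ext h.symm)) (hf κ) (hf κ')
      · exact fun h => absurd hκ h
    · simp [Finsupp.notMem_support_iff.1 hκ]
  have h1 : ‖g‖ ^ 2 = ∑ κ ∈ f.support, (κ : ℝ) * ‖K (f κ)‖ ^ 2 := by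
    rw [← real_inner_self_eq_norm_sq]
    nth_rewrite 1 [show g = ∑ κ ∈ f.support, f κ from rfl]
    rw [sum_inner]
    exact Finset.sum_congr rfl fun κ _ => by rw [(hf κ).2 g hgY, hKg]
  have h2 : ‖K g‖ ^ 2 = ∑ κ ∈ f.support, ‖K (f κ)‖ ^ 2 := by
    rw [← real_inner_self_eq_norm_sq]
    nth_rewrite 1 [show g = ∑ κ ∈ f.support, f κ from rfl]
    rw [map_sum, sum_inner]
    exact Finset.sum_congr rfl fun κ _ => hKg κ
  rw [h1, h2, Finset.mul_sum]
  exact Finset.sum_le_sum fun κ _ => mul_le_mul_of_nonneg_right κ.2 (sq_nonneg _)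

/-- For a Ritz vector `f`, `(f, u) = κ (K f, K u)` with `κ > 0`, so orthogonality to `f` passes to
the images. -/
theorem inner_map_map_eq_zero_of_mem_ritzSpan {S : Set ℝ} {u g : H} (huY : u ∈ Y)
    (hu : u ∈ (ritzSpan K Y S)ᗮ) (hg : g ∈ ritzSpan K Y S) :
    inner ℝ (K g) (K u) = 0 := by
  induction hg using Submodule.iSup_induction' with
  | mem κ f hf =>
    by_cases h0 : f = 0
    · simp [h0]
    have h := hf.2 u huY
    rw [(Submodule.mem_orthogonal _ _).1 hu f (ritzEigenspace_le_ritzSpan κ.2 hf)] at h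
    exact (mul_eq_zero.1 h.symm).resolve_left (pos_of_mem_ritzEigenspace hf h0).ne'
  | zero => simp
  | add x y _ _ hx hy => rw [map_add, inner_add_left, hx, hy, add_zero]

/-- `ν` is the `l`-th smallest Ritz eigenvalue on `Y`, counted with multiplicity. -/
def IsNthRitzValue (K : H →L[ℝ] H) (Y : Submodule ℝ H) (l : ℕ) (ν : ℝ) : Prop :=
  Module.rank ℝ (ritzSpan K Y (Iio ν)) < (l : Cardinal) ∧
    (l : Cardinal) ≤ Module.rank ℝ (ritzSpan K Y (Iic ν))

theorem IsNthRitzValue.pos {l : ℕ} {ν : ℝ} (h : IsNthRitzValue K Y l ν) : 0 < ν := by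
  obtain ⟨g, hg, hg0, -⟩ := Submodule.exists_ne_zero_mem_orthogonal_of_rank_lt h.1 h.2
  have h1 := norm_sq_le_of_mem_ritzSpan_Iic hg
  have := norm_pos_iff.2 hg0
  by_contra! hν
  nlinarith [sq_nonneg ‖K g‖, mul_pos this this]

theorem IsNthRitzValue.le_of_le {l m : ℕ} {ν ν' : ℝ} (h : IsNthRitzValue K Y l ν)
    (h' : IsNthRitzValue K Y m ν') (hlm : l ≤ m) : ν ≤ ν' := by
  by_contra! hlt
  have h1 : Module.rank ℝ (ritzSpan K Y (Iic ν')) ≤ Module.rank ℝ (ritzSpan K Y (Iio ν)) :=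
    Submodule.rank_mono (ritzSpan_mono fun x hx => lt_of_le_of_lt hx hlt)
  have h2 : (l : Cardinal) ≤ m := by exact_mod_cast hlm
  exact absurd (h2.trans (h'.2.trans h1)) (not_le.2 h.1)

/-- Ritz vectors for distinct eigenvalues are orthogonal, hence linearly independent in `Y`. -/
theorem finite_setOf_ritzEigenspace_ne_bot [FiniteDimensional ℝ Y] :
    {κ : ℝ | ritzEigenspace K Y κ ≠ ⊥}.Finite := by
  set D := {κ : ℝ | ritzEigenspace K Y κ ≠ ⊥}
  have hex (κ : D) : ∃ f ∈ ritzEigenspace K Y κ, f ≠ 0 :=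
    Submodule.exists_mem_ne_zero_of_ne_bot κ.2
  choose f hf hf0 using hex
  have hli : LinearIndependent ℝ fun κ : D => (⟨f κ, (hf κ).1⟩ : Y) := by
    refine linearIndependent_of_ne_zero_of_inner_eq_zero
      (fun κ h => hf0 κ (congrArg Subtype.val h)) fun κ κ' hne => ?_
    change inner ℝ (f κ) (f κ') = 0
    rw [(hf κ).2 _ (hf κ').1, inner_map_map_eq_zero_of_mem_ritzEigenspace
      (fun h => hne (Subtype.ext h)) (hf κ) (hf κ'), mul_zero]
  exact Set.finite_coe_iff.1 hli.finite

/-- The largest Ritz eigenvalue in `S` serves as `κ`: only finitely many eigenspaces are nonzero,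
and those from `S` all lie at or below it. -/
theorem exists_mem_le_rank_ritzSpan_Iic [FiniteDimensional ℝ Y] {l : ℕ} (hl : 1 ≤ l) {S : Set ℝ}
    (hS : (l : Cardinal) ≤ Module.rank ℝ (ritzSpan K Y S)) :
    ∃ κ ∈ S, ritzEigenspace K Y κ ≠ ⊥ ∧
      (l : Cardinal) ≤ Module.rank ℝ (ritzSpan K Y (Iic κ)) := by
  set D := S ∩ {κ : ℝ | ritzEigenspace K Y κ ≠ ⊥}
  have hD : D.Finite := finite_setOf_ritzEigenspace_ne_bot.subset inter_subset_right
  have hne : D.Nonempty := by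
    by_contra h
    have : ritzSpan K Y S = ⊥ := by
      refine iSup_eq_bot.2 fun κ => ?_
      by_contra hκ
      exact h ⟨κ, κ.2, hκ⟩
    rw [this, rank_bot] at hS
    have : l ≤ 0 := by exact_mod_cast hS
    omega
  obtain ⟨κ, hκ, hmax⟩ := hD.exists_maximal hne
  refine ⟨κ, hκ.1, hκ.2, hS.trans (Submodule.rank_mono (iSup_le fun κ' => ?_))⟩
  by_cases hb : ritzEigenspace K Y κ' = ⊥
  · rw [hb]; exact bot_le
  · refine ritzEigenspace_le_ritzSpan ?_
    by_contra hlt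
    rw [mem_Iic, not_le] at hlt
    exact absurd (hmax ⟨κ'.2, hb⟩ hlt.le) (not_le.2 hlt)

variable [CompleteSpace H]

theorem mul_norm_sq_le_of_mem_ritzSpan_Iio_orthogonal (hK : IsCompactOperator K)
    (hYc : IsClosed (Y : Set H)) {ν : ℝ} {g : H} (hgY : g ∈ Y)
    (hg : g ∈ (ritzSpan K Y (Iio ν))ᗮ) : ν * ‖K g‖ ^ 2 ≤ ‖g‖ ^ 2 := by
  rcases le_or_gt ν 0 with hν | hν
  · nlinarith [sq_nonneg ‖K g‖, sq_nonneg ‖g‖]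
  set U : Submodule ℝ H := Y ⊓ (ritzSpan K Y (Iio ν))ᗮ with hU
  have hUc : IsClosed (U : Set H) := hYc.inter (Submodule.isClosed_orthogonal _)
  have : CompleteSpace U := hUc.completeSpace_coe
  have : CompleteSpace Y := hYc.completeSpace_coe
  set J : U →L[ℝ] H := K ∘L U.subtypeL with hJ
  have hJapp (u : U) : J u = K u := rfl
  have hJc : IsCompactOperator J := hK.comp_clm U.subtypeL
  -- If this failed, a maximizer `u` of `‖K u‖ / ‖u‖` on `U` would be a Ritz vector with eigenvalue
  -- `‖J‖⁻² < ν`, lying both in the span and in its orthogonal complement.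
  have hle : ν * ‖J‖ ^ 2 ≤ 1 := by
    by_cases hJ0 : ‖J‖ = 0
    · simp [hJ0]
    have h0 : J ≠ 0 := fun h => hJ0 (h ▸ ContinuousLinearMap.opNorm_zero)
    by_contra! hlt
    obtain ⟨u, hu0, hu⟩ := hJc.exists_inner_map_map_eq h0
    set s := ‖J‖ ^ 2 with hs
    have hspos : 0 < s := pow_pos (lt_of_le_of_ne (norm_nonneg J) (Ne.symm hJ0)) 2
    -- The maximizer satisfies its equation only against `U`. The residual `w` within `Y` is
    -- orthogonal to the span as well, so it lies in `U`, may be used as a test vector, and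
    -- vanishes; the equation then holds against all of `Y`.
    set w : H := Y.starProjection (K.adjoint (K u)) - s • (u : H) with hw
    have hinn (v : H) (hv : v ∈ Y) :
        inner ℝ w v = inner ℝ (K u) (K v) - s * inner ℝ (u : H) v := by
      rw [hw, inner_sub_left, real_inner_smul_left, Submodule.inner_starProjection_left_eq_right,
        Submodule.starProjection_eq_self_iff.2 hv, ContinuousLinearMap.adjoint_inner_left]
    have hwY : w ∈ Y := Y.sub_mem (Submodule.starProjection_apply_mem _ _) (Y.smul_mem _ u.2.1)
    have hwU : w ∈ U := by
      refine ⟨hwY, (Submodule.mem_orthogonal _ _).2 fun v hv => ?_⟩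
      rw [real_inner_comm, hinn v (ritzSpan_le _ hv), real_inner_comm,
        inner_map_map_eq_zero_of_mem_ritzSpan u.2.1 u.2.2 hv, real_inner_comm,
        (Submodule.mem_orthogonal _ _).1 u.2.2 v hv]
      simp
    have hw0 : w = 0 := by
      rw [← inner_self_eq_zero (𝕜 := ℝ), hinn w hwY]
      have := hu ⟨w, hwU⟩
      rw [hJapp, hJapp, Submodule.coe_inner] at this
      rw [this, sub_self]
    have hueig : (u : H) ∈ ritzEigenspace K Y s⁻¹ := by
      refine ⟨u.2.1, fun v hv => ?_⟩
      have := hinn v hv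
      rw [hw0, inner_zero_left] at this
      rw [show inner ℝ (K u) (K v) = s * inner ℝ (u : H) v by linarith]
      field_simp
    have hmem : (u : H) ∈ ritzSpan K Y (Iio ν) :=
      ritzEigenspace_le_ritzSpan (by rw [mem_Iio, inv_lt_iff_one_lt_mul₀ hspos]; linarith) hueig
    have := (Submodule.mem_orthogonal _ _).1 u.2.2 _ hmem
    rw [inner_self_eq_zero] at this
    exact hu0 (Subtype.ext this)
  have h1 : ‖K g‖ ≤ ‖J‖ * ‖g‖ := J.le_opNorm ⟨g, hgY, hg⟩
  calc ν * ‖K g‖ ^ 2 ≤ ν * (‖J‖ * ‖g‖) ^ 2 := by gcongr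
    _ = (ν * ‖J‖ ^ 2) * ‖g‖ ^ 2 := by ring
    _ ≤ 1 * ‖g‖ ^ 2 := by gcongr
    _ = ‖g‖ ^ 2 := one_mul _

/-- Max-min bound from below. -/
theorem IsNthRitzValue.le_of_subspace_le {Z : Submodule ℝ H} (hK : IsCompactOperator K)
    (hYc : IsClosed (Y : Set H)) (hZY : Z ≤ Y) {l : ℕ} {μ ν : ℝ} (hμ : IsNthRitzValue K Y l μ)
    (hν : IsNthRitzValue K Z l ν) : μ ≤ ν := by
  obtain ⟨g, hg, hg0, hgo⟩ := Submodule.exists_ne_zero_mem_orthogonal_of_rank_lt hμ.1 hν.2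
  have h1 := norm_sq_le_of_mem_ritzSpan_Iic hg
  have h2 := mul_norm_sq_le_of_mem_ritzSpan_Iio_orthogonal hK hYc (hZY (ritzSpan_le _ hg)) hgo
  have := norm_pos_iff.2 hg0
  by_contra! hlt
  have h3 : 0 < ‖K g‖ ^ 2 := by
    have := hν.pos
    by_contra! h
    nlinarith [mul_pos (norm_pos_iff.2 hg0) (norm_pos_iff.2 hg0)]
  nlinarith

/-- Min-max bound from above by a trial subspace. -/
theorem IsNthRitzValue.le_of_trial_subspace (hK : IsCompactOperator K)
    (hYc : IsClosed (Y : Set H)) {l : ℕ} {M ν : ℝ} (hν : IsNthRitzValue K Y l ν)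
    {W : Submodule ℝ H} (hWY : W ≤ Y) (hWl : (l : Cardinal) ≤ Module.rank ℝ W)
    (hW : ∀ g ∈ W, ‖g‖ ^ 2 ≤ M * ‖K g‖ ^ 2) : ν ≤ M := by
  obtain ⟨g, hg, hg0, hgo⟩ := Submodule.exists_ne_zero_mem_orthogonal_of_rank_lt hν.1 hWl
  have h1 := hW g hg
  have h2 := mul_norm_sq_le_of_mem_ritzSpan_Iio_orthogonal hK hYc (hWY hg) hgo
  by_contra! hlt
  have hpos := mul_pos (norm_pos_iff.2 hg0) (norm_pos_iff.2 hg0)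
  have h3 : ‖K g‖ ^ 2 ≠ 0 := by
    intro h
    rw [h] at h1
    nlinarith
  have : 0 < ‖K g‖ ^ 2 := lt_of_le_of_ne (sq_nonneg _) h3.symm
  nlinarith

theorem exists_isNthRitzValue [FiniteDimensional ℝ Y] (hK : IsCompactOperator K)
    (hinj : ∀ g ∈ Y, K g = 0 → g = 0) {l : ℕ} (hl : 1 ≤ l)
    (hlY : (l : Cardinal) ≤ Module.rank ℝ Y) : ∃ ν, IsNthRitzValue K Y l ν := by
  have htop : ritzSpan K Y univ = Y := by
    have : FiniteDimensional ℝ (ritzSpan K Y univ) :=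
      Submodule.finiteDimensional_of_le (ritzSpan_le _)
    -- A vector `g` orthogonal to all Ritz vectors satisfies `ν ‖K g‖² ≤ ‖g‖²` for every `ν`; the
    -- value of `ν` below makes the left side `‖g‖² + 1` unless `K g = 0`.
    have hbot : (ritzSpan K Y univ)ᗮ ⊓ Y = ⊥ := by
      refine (Submodule.eq_bot_iff _).2 fun g hg => hinj g hg.2 ?_
      by_contra h0
      have hpos : 0 < ‖K g‖ ^ 2 := by have := norm_pos_iff.2 h0; positivity
      have h := mul_norm_sq_le_of_mem_ritzSpan_Iio_orthogonal hK Y.closed_of_finiteDimensional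
        (ν := (‖g‖ ^ 2 + 1) / ‖K g‖ ^ 2) hg.2
        (Submodule.orthogonal_le (ritzSpan_mono (subset_univ _)) hg.1)
      rw [div_mul_cancel₀ _ hpos.ne'] at h
      linarith
    have h := Submodule.sup_orthogonal_inf_of_hasOrthogonalProjection
      (ritzSpan_le (K := K) (Y := Y) univ)
    rwa [hbot, sup_bot_eq] at h
  set C := {κ : ℝ | ritzEigenspace K Y κ ≠ ⊥ ∧
    (l : Cardinal) ≤ Module.rank ℝ (ritzSpan K Y (Iic κ))}
  have hC : C.Finite := finite_setOf_ritzEigenspace_ne_bot.subset fun κ h => h.1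
  obtain ⟨κ₀, -, hκ₀⟩ := exists_mem_le_rank_ritzSpan_Iic hl (S := univ) (by rwa [htop])
  obtain ⟨ν, hν, hmin⟩ := hC.exists_minimal ⟨κ₀, hκ₀⟩
  refine ⟨ν, ?_, hν.2⟩
  by_contra! h
  obtain ⟨κ, hκν, hκ⟩ := exists_mem_le_rank_ritzSpan_Iic hl h
  exact absurd (hmin hκ (le_of_lt hκν)) (not_le.2 hκν)

end SpectralTheory

/-! ### Compactness of integral operators with square-integrable kernel. -/

noncomputable section HilbertSchmidt

/-- An operator whose Hilbert–Schmidt sums are bounded is compact. -/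
theorem isCompactOperator_of_sum_norm_sq_le {H F : Type*} [NormedAddCommGroup H]
    [InnerProductSpace ℝ H] [NormedAddCommGroup F] [NormedSpace ℝ F] [CompleteSpace F]
    {K : H →L[ℝ] F} {C : ℝ}
    (hC : ∀ s : Finset H, Orthonormal ℝ (Subtype.val : s → H) → ∑ e ∈ s, ‖K e‖ ^ 2 ≤ C) :
    IsCompactOperator K := by
  classical
  set S : Set ℝ :=
    {c | ∃ s : Finset H, Orthonormal ℝ (Subtype.val : s → H) ∧ ∑ e ∈ s, ‖K e‖ ^ 2 = c} with hS
  have hSb : BddAbove S := ⟨C, by rintro _ ⟨s, hs, rfl⟩; exact hC s hs⟩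
  have hSne : S.Nonempty := ⟨0, ∅, ⟨fun i => (Finset.notMem_empty _ i.2).elim,
    fun i => (Finset.notMem_empty _ i.2).elim⟩,
    by simp⟩
  have happ : ∀ ε > 0, ∃ L : H →L[ℝ] F, IsCompactOperator L ∧ ‖L - K‖ ≤ ε := by
    intro ε hε
    -- Since `s` comes within `ε²` of the supremum, adjoining a unit vector `e ⊥ s` can add at most
    -- `ε²`. Hence `‖K e‖ ≤ ε`, and `K` is within `ε` of the finite-rank operator `K ∘ P_V`.
    obtain ⟨_, ⟨s, hs, rfl⟩, hlt⟩ := exists_lt_of_lt_csSup hSne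
      (sub_lt_self (sSup S) (by positivity : 0 < ε ^ 2))
    set V : Submodule ℝ H := Submodule.span ℝ (s : Set H) with hV
    have : FiniteDimensional ℝ V := FiniteDimensional.span_finset ℝ s
    have hunit (e : H) (he : e ∈ Vᗮ) (he1 : ‖e‖ = 1) : ‖K e‖ ≤ ε := by
      have horth (v : H) (hv : v ∈ s) : inner ℝ v e = 0 :=
        (Submodule.mem_orthogonal _ _).1 he v (Submodule.subset_span hv)
      have hes : e ∉ s := fun h => by
        have := horth e h
        rw [real_inner_self_eq_norm_sq, he1] at this
        norm_num at this
      have hins : Orthonormal ℝ (Subtype.val : ↥(insert e s : Finset H) → H) := by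
        have h1 : ∀ v ∈ (s : Set H), ∀ w ∈ (s : Set H), inner ℝ v w = if v = w then (1 : ℝ) else 0 :=
          orthonormal_subtype_iff_ite.1 hs
        have h2 : ∀ v ∈ ((insert e s : Finset H) : Set H), ∀ w ∈ ((insert e s : Finset H) : Set H),
            inner ℝ v w = if v = w then (1 : ℝ) else 0 := by
          intro v hv w hw
          rcases Finset.mem_insert.1 hv with hve | hvs <;>
            rcases Finset.mem_insert.1 hw with hwe | hws
          · rw [hve, hwe, real_inner_self_eq_norm_sq, he1]; simp
          · rw [hve, real_inner_comm, horth w hws, if_neg fun h => hes (by rwa [h])]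
          · rw [hwe, horth v hvs, if_neg fun h => hes (by rwa [← h])]
          · exact h1 v hvs w hws
        exact orthonormal_subtype_iff_ite.2 h2
      have h3 := le_csSup hSb ⟨_, hins, rfl⟩
      rw [Finset.sum_insert hes] at h3
      exact le_of_sq_le_sq (by linarith) hε.le
    refine ⟨K ∘L V.starProjection, ?_, ContinuousLinearMap.opNorm_le_bound _ hε.le fun x => ?_⟩
    · have : ProperSpace V := FiniteDimensional.proper ℝ V
      have h : IsCompactOperator (V.orthogonalProjectionOnto : H →L[ℝ] V) :=
        isCompactOperator_of_locallyCompactSpace_dom _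
      exact h.clm_comp (K ∘L V.subtypeL)
    · set y := x - V.starProjection x with hy
      have hyV : y ∈ Vᗮ := Submodule.sub_starProjection_mem_orthogonal x
      have h1 : (K ∘L V.starProjection - K) x = -K y := by
        simp [hy]
      have h2 : ‖y‖ ≤ ‖x‖ := by
        have := Submodule.norm_sq_eq_add_norm_sq_starProjection x V
        rw [Submodule.starProjection_orthogonal_val] at this
        exact le_of_sq_le_sq (by rw [hy]; nlinarith [sq_nonneg ‖V.starProjection x‖]) (norm_nonneg x)
      rw [h1, norm_neg]
      by_cases h0 : y = 0
      · rw [h0, map_zero, norm_zero]; positivity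
      have hy0 := norm_pos_iff.2 h0
      have h4 := hunit (‖y‖⁻¹ • y) (Submodule.smul_mem _ _ hyV) (by
        rw [norm_smul, norm_inv, norm_norm, inv_mul_cancel₀ hy0.ne'])
      rw [map_smul, norm_smul, norm_inv, norm_norm, inv_mul_le_iff₀ hy0] at h4
      calc ‖K y‖ ≤ ‖y‖ * ε := h4
        _ ≤ ε * ‖x‖ := by rw [mul_comm]; gcongr
  have hcl : K ∈ closure {L : H →L[ℝ] F | IsCompactOperator L} := by
    refine Metric.mem_closure_iff.2 fun ε hε => ?_
    obtain ⟨L, hL, hLK⟩ := happ (ε / 2) (half_pos hε)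
    exact ⟨L, hL, by rw [dist_comm, dist_eq_norm]; linarith⟩
  rwa [isClosed_setOfPred_isCompactOperator.closure_eq] at hcl

theorem sum_norm_sq_integralOperator_le {a b : ℝ} {k : ℝ → ℝ → ℝ}
    (hk : SquareIntegrableKernel a b k) (s : Finset (L2 a b))
    (hs : Orthonormal ℝ (Subtype.val : s → L2 a b)) :
    ∑ e ∈ s, ‖integralOperator hk e‖ ^ 2 ≤ (eLpNorm (Function.uncurry k) 2
      ((intervalMeasure a b).prod (intervalMeasure a b)) ^ 2).toReal := by
  have hsec : ∀ᵐ x ∂(intervalMeasure a b), MemLp (k x) 2 (intervalMeasure a b) := by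
    have h1 : ∫⁻ x, ∫⁻ y, ‖k x y‖ₑ ^ 2 ∂(intervalMeasure a b) ∂(intervalMeasure a b) ≠ ⊤ := by
      have := eLpNorm_two_sq ((intervalMeasure a b).prod (intervalMeasure a b)) (Function.uncurry k)
      rw [lintegral_prod _ (hk.1.enorm.pow_const 2)] at this
      exact this ▸ ENNReal.pow_ne_top hk.2.ne
    have h2 : AEMeasurable (fun x => ∫⁻ y, ‖k x y‖ₑ ^ 2 ∂(intervalMeasure a b))
        (intervalMeasure a b) :=
      (hk.1.enorm.pow_const 2).lintegral_prod_right'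
    filter_upwards [hk.1.prodMk_left, ae_lt_top' h2 h1] with x hx hx'
    refine ⟨hx, ?_⟩
    change ∫⁻ y, ‖k x y‖ₑ ^ 2 ∂(intervalMeasure a b) < ⊤ at hx'
    rw [← eLpNorm_two_sq] at hx'
    by_contra h
    rw [not_lt, top_le_iff] at h
    change eLpNorm (fun y => k x y) 2 (intervalMeasure a b) = ⊤ at h
    simp [h] at hx'
  have hae : ∀ᵐ x ∂(intervalMeasure a b), ∀ e ∈ s, integralOperator hk e x =
      ∫ y, k x y * e y ∂(intervalMeasure a b) :=
    (ae_ball_iff s.countable_toSet).2 fun e _ => coeFn_integralOperator hk e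
  -- For almost every `x`, `K e (x)` is the inner product of `e` with the section `k x`, so this is
  -- Bessel's inequality; integrating over `x` gives the claim.
  have hbessel : ∀ᵐ x ∂(intervalMeasure a b), ∑ e ∈ s, ‖integralOperator hk e x‖ₑ ^ 2 ≤
      ∫⁻ y, ‖k x y‖ₑ ^ 2 ∂(intervalMeasure a b) := by
    filter_upwards [hsec, hae] with x hx hx'
    set g : L2 a b := hx.toLp (k x) with hg
    have hinner (e : L2 a b) (he : e ∈ s) : integralOperator hk e x = inner ℝ e g := by
      rw [hx' e he, L2.inner_def]
      refine integral_congr_ae ?_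
      filter_upwards [hx.coeFn_toLp] with y hy
      simp [hg, hy]
    have h1 : ∑ e ∈ s, ‖inner ℝ e g‖ ^ 2 ≤ ‖g‖ ^ 2 := by
      have := hs.sum_inner_products_le g (s := s.attach)
      rwa [s.sum_attach (fun e => ‖inner ℝ e g‖ ^ 2)] at this
    rw [← eLpNorm_two_sq]
    have h2 : eLpNorm (fun y => k x y) 2 (intervalMeasure a b) = ‖g‖ₑ := by
      rw [hg, Lp.enorm_toLp]
    rw [h2, Finset.sum_congr rfl fun e he => by rw [hinner e he]]
    simp only [← ofReal_norm, ← ENNReal.ofReal_pow (norm_nonneg _)]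
    rw [← ENNReal.ofReal_sum_of_nonneg fun e _ => sq_nonneg _]
    exact ENNReal.ofReal_le_ofReal h1
  have hmain : ∑ e ∈ s, ‖integralOperator hk e‖ₑ ^ 2 ≤ eLpNorm (Function.uncurry k) 2
      ((intervalMeasure a b).prod (intervalMeasure a b)) ^ 2 := by
    rw [eLpNorm_two_sq, lintegral_prod _ (hk.1.enorm.pow_const 2)]
    refine le_trans (le_of_eq ?_) (lintegral_mono_ae hbessel)
    rw [lintegral_finsetSum' _ fun e _ => (Lp.aestronglyMeasurable _).enorm.pow_const 2]
    exact Finset.sum_congr rfl fun e _ => by rw [← eLpNorm_two_sq, Lp.enorm_def]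
  have := ENNReal.toReal_mono (ENNReal.pow_ne_top hk.2.ne) hmain
  rw [ENNReal.toReal_sum fun e _ => by finiteness] at this
  simpa using this

theorem isCompactOperator_integralOperator {a b : ℝ} {k : ℝ → ℝ → ℝ}
    (hk : SquareIntegrableKernel a b k) : IsCompactOperator (integralOperator hk) :=
  isCompactOperator_of_sum_norm_sq_le (sum_norm_sq_integralOperator_le hk)

end HilbertSchmidt

/-! ### Reduction of the differential eigenproblem to the Ritz problem. -/

noncomputable section WeakDerivative

variable {a b : ℝ}

theorem HasWeakDeriv.unique {u g₁ g₂ : L2 a b} (h₁ : HasWeakDeriv u g₁) (h₂ : HasWeakDeriv u g₂) :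
    g₁ = g₂ := by
  have hint (g : L2 a b) : Integrable g (intervalMeasure a b) :=
    (Lp.memLp g).integrable (by norm_num)
  have hmul (g : L2 a b) {φ : ℝ → ℝ} (hφ : ContDiff ℝ ∞ φ) (hc : HasCompactSupport φ) :
      Integrable (fun x => g x * φ x) (intervalMeasure a b) := by
    obtain ⟨C, hC⟩ := hc.exists_bound_of_continuous hφ.continuous
    exact (hint g).mul_bdd (c := C) hφ.continuous.aestronglyMeasurable (Filter.Eventually.of_forall hC)
  have hz : ∀ᵐ x ∂(volume : Measure ℝ), x ∈ Ioo a b → (g₁ x - g₂ x) = 0 := by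
    refine isOpen_Ioo.ae_eq_zero_of_integral_contDiff_smul_eq_zero (f := fun x => g₁ x - g₂ x) ?_ ?_
    · exact IntegrableOn.locallyIntegrableOn ((hint g₁).sub (hint g₂))
    · intro φ hφ hc hsupp
      have h3 := (h₁ φ hφ hc hsupp).symm.trans (h₂ φ hφ hc hsupp)
      have h4 : ∫ x, φ x • (g₁ x - g₂ x) ∂(intervalMeasure a b) = 0 := by
        simp only [smul_eq_mul, mul_comm (φ _), sub_mul]
        rw [integral_sub (hmul g₁ hφ hc) (hmul g₂ hφ hc)]
        linarith
      rw [setIntegral_eq_integral_of_forall_compl_eq_zero] at h4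
      · exact h4
      · intro x hx
        rw [image_eq_zero_of_notMem_tsupport fun h => hx (hsupp h), zero_smul]
  refine Lp.ext ?_
  filter_upwards [(ae_restrict_iff' measurableSet_Ioo).2 hz] with x hx
  exact sub_eq_zero.1 hx

theorem HasWeakDeriv.const_smul {u g : L2 a b} (h : HasWeakDeriv u g) (c : ℝ) :
    HasWeakDeriv (c • u) (c • g) := by
  intro φ hφ hc hsupp
  have hmul (w : L2 a b) (θ : ℝ → ℝ) : ∫ x, (c • w : L2 a b) x * θ x ∂(intervalMeasure a b) =
      c * ∫ x, w x * θ x ∂(intervalMeasure a b) := by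
    rw [← integral_const_mul]
    refine integral_congr_ae ?_
    filter_upwards [Lp.coeFn_smul c w] with x hx
    rw [hx, Pi.smul_apply, smul_eq_mul, mul_assoc]
  rw [hmul, hmul, h φ hφ hc hsupp, mul_neg]

theorem DerivInvertsOperator.hasWeakDeriv {K : L2 a b →L[ℝ] L2 a b} (hK : DerivInvertsOperator K)
    {f : L2 a b} (hf : f ∈ (LinearMap.ker K.toLinearMap)ᗮ) : HasWeakDeriv (K f) f := by
  -- The hypothesis on `∂K` concerns the unit ball only. Scaling by `‖f‖ + 1` rather than `‖f‖`
  -- avoids the case `f = 0`.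
  set c : ℝ := ‖f‖ + 1 with hc
  have hc0 : 0 < c := by positivity
  have h := (hK 0).1 (c⁻¹ • f) ⟨?_, fun v hv => ?_⟩
  · have := h.const_smul c
    rwa [← map_smul, smul_inv_smul₀ hc0.ne'] at this
  · rw [mem_closedBall_zero_iff, norm_smul, norm_inv, Real.norm_of_nonneg hc0.le,
      inv_mul_le_iff₀ hc0]
    linarith
  · rw [real_inner_smul_left, real_inner_comm, (Submodule.mem_orthogonal _ _).1 hf v hv, mul_zero]

variable {K : L2 a b →L[ℝ] L2 a b} {Y : Submodule ℝ (L2 a b)}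

theorem eq_zero_of_mem_orthogonal_ker {H : Type*} [NormedAddCommGroup H] [InnerProductSpace ℝ H]
    {K : H →L[ℝ] H} {f : H} (hf : f ∈ (LinearMap.ker K.toLinearMap)ᗮ) (h : K f = 0) : f = 0 :=
  inner_self_eq_zero.1 ((Submodule.mem_orthogonal _ _).1 hf f h)

/-- On `(ker K)ᗮ` the weak derivative of `K f` exists and is `f`; by uniqueness no other derivative
can occur in the eigenvalue equation. -/
theorem isEigenpair_map_iff (hK : DerivInvertsOperator K)
    (hY : Y ≤ (LinearMap.ker K.toLinearMap)ᗮ) {κ : ℝ} {ψ : L2 a b} :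
    IsEigenpair (Y.map K.toLinearMap) κ ψ ↔ ∃ f ∈ ritzEigenspace K Y κ, f ≠ 0 ∧ K f = ψ := by
  constructor
  · rintro ⟨⟨f, hf, rfl⟩, h0, dψ, hdψ, h⟩
    refine ⟨f, ⟨hf, fun g hg => ?_⟩, fun h1 => h0 (by simp [h1]), rfl⟩
    obtain ⟨dv, hdv, hinner⟩ := h (K g) ⟨g, hg, rfl⟩
    rwa [hdψ.unique (hK.hasWeakDeriv (hY hf)), hdv.unique (hK.hasWeakDeriv (hY hg))] at hinner
  · rintro ⟨f, hf, h0, rfl⟩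
    refine ⟨⟨f, hf.1, rfl⟩, fun h => h0 (eq_zero_of_mem_orthogonal_ker (hY hf.1) h), f,
      hK.hasWeakDeriv (hY hf.1), ?_⟩
    rintro _ ⟨g, hg, rfl⟩
    exact ⟨g, hK.hasWeakDeriv (hY hg), hf.2 g hg⟩

/-- Multiplicities agree because `K` is injective on `(ker K)ᗮ` and maps Ritz vectors onto
eigenfunctions. -/
theorem rank_span_isEigenpair_map (hK : DerivInvertsOperator K)
    (hY : Y ≤ (LinearMap.ker K.toLinearMap)ᗮ) (S : Set ℝ) :
    Module.rank ℝ (Submodule.span ℝ {ψ | ∃ κ ∈ S, IsEigenpair (Y.map K.toLinearMap) κ ψ}) =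
      Module.rank ℝ (ritzSpan K Y S) := by
  have hspan : Submodule.span ℝ {ψ | ∃ κ ∈ S, IsEigenpair (Y.map K.toLinearMap) κ ψ} =
      (ritzSpan K Y S).map K.toLinearMap := by
    refine le_antisymm (Submodule.span_le.2 ?_) (Submodule.map_le_iff_le_comap.2 ?_)
    · rintro ψ ⟨κ, hκ, hψ⟩
      obtain ⟨f, hf, -, rfl⟩ := (isEigenpair_map_iff hK hY).1 hψ
      exact ⟨f, ritzEigenspace_le_ritzSpan hκ hf, rfl⟩
    · refine iSup_le fun κ f hf => ?_
      by_cases h0 : f = 0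
      · rw [h0]; exact Submodule.zero_mem _
      · exact Submodule.subset_span ⟨κ, κ.2, (isEigenpair_map_iff hK hY).2 ⟨f, hf, h0, rfl⟩⟩
  have hinj : Function.Injective (K.toLinearMap.domRestrict (ritzSpan K Y S)) := by
    rw [injective_iff_map_eq_zero]
    exact fun f hf => Subtype.ext (eq_zero_of_mem_orthogonal_ker (hY (ritzSpan_le _ f.2)) hf)
  rw [hspan, ← LinearMap.range_domRestrict]
  exact (LinearEquiv.ofInjective _ hinj).rank_eq.symm

theorem isNthEigenvalue_map_iff (hK : DerivInvertsOperator K)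
    (hY : Y ≤ (LinearMap.ker K.toLinearMap)ᗮ) {l : ℕ} {ν : ℝ} :
    IsNthEigenvalue (Y.map K.toLinearMap) l ν ↔ IsNthRitzValue K Y l ν := by
  have h1 := rank_span_isEigenpair_map hK hY (Iio ν)
  have h2 := rank_span_isEigenpair_map hK hY (Iic ν)
  rw [IsNthEigenvalue, IsNthRitzValue, ← h1, ← h2]
  rfl

theorem range_eq_map_orthogonal_ker {H : Type*} [NormedAddCommGroup H] [InnerProductSpace ℝ H]
    [CompleteSpace H] (K : H →L[ℝ] H) :
    LinearMap.range K.toLinearMap =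
      (LinearMap.ker K.toLinearMap)ᗮ.map K.toLinearMap := by
  refine le_antisymm ?_ (LinearMap.map_le_range)
  rintro _ ⟨f, rfl⟩
  have : CompleteSpace (LinearMap.ker K.toLinearMap) := K.isClosed_ker.completeSpace_coe
  refine ⟨f - (LinearMap.ker K.toLinearMap).starProjection f,
    Submodule.sub_starProjection_mem_orthogonal f, ?_⟩
  have h := Submodule.starProjection_apply_mem (LinearMap.ker K.toLinearMap) f
  rw [map_sub, LinearMap.mem_ker.1 h, sub_zero]

end WeakDerivative

/-! ### Projection errors of the iterated subspaces and the trial-space estimate. -/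

noncomputable section Approximation

variable {H : Type*} [NormedAddCommGroup H] [InnerProductSpace ℝ H]

theorem norm_sub_starProjection_le_norm_sub (V : Submodule ℝ H) [V.HasOrthogonalProjection]
    (x : H) {v : H} (hv : v ∈ V) : ‖x - V.starProjection x‖ ≤ ‖x - v‖ := by
  rw [V.starProjection_minimal]
  exact ciInf_le ⟨0, by rintro _ ⟨y, rfl⟩; exact norm_nonneg _⟩ (⟨v, hv⟩ : V)

theorem norm_sub_starProjection_le_norm (V : Submodule ℝ H) [V.HasOrthogonalProjection] (x : H) :
    ‖x - V.starProjection x‖ ≤ ‖x‖ := by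
  simpa using norm_sub_starProjection_le_norm_sub V x V.zero_mem

/-- The error bound `‖(I - P_X) L f‖ ≤ d ‖f‖` expressed through the distance of the image of the
unit ball. -/
theorem distToSubspace_image_closedBall_le_iff {L : H →L[ℝ] H} {X : Submodule ℝ H}
    [X.HasOrthogonalProjection] {d : ℝ} (hd : 0 ≤ d) :
    distToSubspace (L '' Metric.closedBall 0 1) X ≤ ENNReal.ofReal d ↔
      ∀ f, ‖L f - X.starProjection (L f)‖ ≤ d * ‖f‖ := by
  simp only [distToSubspace, iSup_le_iff, forall_mem_image, ← ofReal_norm,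
    ENNReal.ofReal_le_ofReal_iff hd, mem_closedBall_zero_iff]
  refine ⟨fun h f => ?_, fun h f hf => (h f).trans (mul_le_of_le_one_right hd hf)⟩
  by_cases h0 : f = 0
  · simp [h0]
  have hf := norm_pos_iff.2 h0
  have h1 := @h (‖f‖⁻¹ • f) (by rw [norm_smul, norm_inv, norm_norm, inv_mul_cancel₀ hf.ne'])
  rwa [map_smul, map_smul, ← smul_sub, norm_smul, norm_inv, norm_norm, inv_mul_le_iff₀ hf,
    mul_comm] at h1

variable [CompleteSpace H]

/-- On `Xᗮ` the operator `L*` coincides with the adjoint of `(I - P_X) L`, which has the same norm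
bound. -/
theorem norm_adjoint_le_of_mem_orthogonal {L : H →L[ℝ] H} {X : Submodule ℝ H}
    [X.HasOrthogonalProjection] {d : ℝ} (h : ∀ f, ‖L f - X.starProjection (L f)‖ ≤ d * ‖f‖)
    {r : H} (hr : r ∈ Xᗮ) : ‖L.adjoint r‖ ≤ d * ‖r‖ := by
  have h1 : ‖L.adjoint r‖ ^ 2 =
      inner ℝ r (L (L.adjoint r) - X.starProjection (L (L.adjoint r))) := by
    rw [inner_sub_right, real_inner_comm (X.starProjection _), (Submodule.mem_orthogonal _ _).1 hr _
      (Submodule.starProjection_apply_mem _ _), sub_zero, ← real_inner_self_eq_norm_sq,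
      ContinuousLinearMap.adjoint_inner_left]
  have h2 := (real_inner_le_norm r _).trans
    (mul_le_mul_of_nonneg_left (h (L.adjoint r)) (norm_nonneg r))
  rw [← h1] at h2
  by_cases h0 : ‖L.adjoint r‖ = 0
  · have h3 := h r
    have : 0 ≤ d * ‖r‖ := (norm_nonneg _).trans h3
    rwa [h0]
  · have := lt_of_le_of_ne (norm_nonneg (L.adjoint r)) (Ne.symm h0)
    by_contra! hlt
    nlinarith

/-- The competitor `L* P_X x` leaves the error `L* (x - P_X x)`, whose argument is in `Xᗮ`. This is
where each iteration gains its factor `d`. -/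
theorem norm_adjoint_sub_starProjection_map_le {L : H →L[ℝ] H} {X : Submodule ℝ H}
    [FiniteDimensional ℝ X] {d : ℝ} (h : ∀ f, ‖L f - X.starProjection (L f)‖ ≤ d * ‖f‖) (x : H) :
    ‖L.adjoint x - (X.map L.adjoint.toLinearMap).starProjection (L.adjoint x)‖ ≤
      d * ‖x - X.starProjection x‖ := by
  refine (norm_sub_starProjection_le_norm_sub _ _
    (⟨_, Submodule.starProjection_apply_mem X x, rfl⟩ :
      L.adjoint (X.starProjection x) ∈ X.map L.adjoint.toLinearMap)).trans ?_
  rw [← map_sub]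
  exact norm_adjoint_le_of_mem_orthogonal h (Submodule.sub_starProjection_mem_orthogonal x)

theorem norm_sub_starProjection_map_le {L : H →L[ℝ] H} {Y : Submodule ℝ H}
    [FiniteDimensional ℝ Y] {d : ℝ}
    (h : ∀ f, ‖L.adjoint f - Y.starProjection (L.adjoint f)‖ ≤ d * ‖f‖) (x : H) :
    ‖L x - (Y.map L.toLinearMap).starProjection (L x)‖ ≤ d * ‖x - Y.starProjection x‖ := by
  have := norm_adjoint_sub_starProjection_map_le (L := L.adjoint) h x
  simpa only [ContinuousLinearMap.adjoint_adjoint] using this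

/-- The subspace `Y_p`. -/
def subspaceY (K : H →L[ℝ] H) (X₀ Y₀ : Submodule ℝ H) (p : ℕ) : Submodule ℝ H :=
  (subspacePair K X₀ Y₀ p).2

variable {K : H →L[ℝ] H} {X₀ Y₀ : Submodule ℝ H}

theorem finiteDimensional_subspacePair [hX : FiniteDimensional ℝ X₀] [hY : FiniteDimensional ℝ Y₀]
    (p : ℕ) : FiniteDimensional ℝ (subspaceX K X₀ Y₀ p) ∧
      FiniteDimensional ℝ (subspaceY K X₀ Y₀ p) := by
  induction p with
  | zero => exact ⟨hX, hY⟩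
  | succ p ih =>
    have h1 := ih.1
    have h2 := ih.2
    exact ⟨inferInstanceAs (FiniteDimensional ℝ ((subspaceY K X₀ Y₀ p).map K.toLinearMap)),
      inferInstanceAs (FiniteDimensional ℝ ((subspaceX K X₀ Y₀ p).map K.adjoint.toLinearMap))⟩

instance [FiniteDimensional ℝ X₀] [FiniteDimensional ℝ Y₀] (p : ℕ) :
    FiniteDimensional ℝ (subspaceX K X₀ Y₀ p) := (finiteDimensional_subspacePair p).1

instance [FiniteDimensional ℝ X₀] [FiniteDimensional ℝ Y₀] (p : ℕ) :
    FiniteDimensional ℝ (subspaceY K X₀ Y₀ p) := (finiteDimensional_subspacePair p).2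

theorem subspaceY_le_orthogonal_ker (hY₀ : Y₀ ≤ (LinearMap.ker K.toLinearMap)ᗮ) (p : ℕ) :
    subspaceY K X₀ Y₀ p ≤ (LinearMap.ker K.toLinearMap)ᗮ := by
  cases p with
  | zero => exact hY₀
  | succ p =>
    rintro _ ⟨x, -, rfl⟩
    refine (Submodule.mem_orthogonal _ _).2 fun v hv => ?_
    change inner ℝ v (K.adjoint x) = 0
    rw [ContinuousLinearMap.adjoint_inner_right, show K v = 0 from hv, inner_zero_left]

variable [FiniteDimensional ℝ X₀] [FiniteDimensional ℝ Y₀]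

theorem norm_sub_starProjection_subspacePair_le {d : ℝ} (hd : 0 ≤ d)
    (hX : ∀ f, ‖K f - X₀.starProjection (K f)‖ ≤ d * ‖f‖)
    (hY : ∀ f, ‖K.adjoint f - Y₀.starProjection (K.adjoint f)‖ ≤ d * ‖f‖) (p : ℕ) :
    (∀ f, ‖K f - (subspaceX K X₀ Y₀ p).starProjection (K f)‖ ≤ d * ‖f‖) ∧
      ∀ f, ‖K.adjoint f - (subspaceY K X₀ Y₀ p).starProjection (K.adjoint f)‖ ≤ d * ‖f‖ := by
  induction p with
  | zero => exact ⟨hX, hY⟩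
  | succ p ih =>
    exact ⟨fun f => (norm_sub_starProjection_map_le ih.2 f).trans
        (mul_le_mul_of_nonneg_left (norm_sub_starProjection_le_norm _ f) hd),
      fun f => (norm_adjoint_sub_starProjection_map_le ih.1 f).trans
        (mul_le_mul_of_nonneg_left (norm_sub_starProjection_le_norm _ f) hd)⟩

/-- Geometric decay of the errors on a subspace `G` on which `K* K` is onto and bounded below. -/
theorem norm_sub_starProjection_subspacePair_le_pow {d : ℝ} (hd : 0 ≤ d)
    (hX : ∀ f, ‖K f - X₀.starProjection (K f)‖ ≤ d * ‖f‖)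
    (hY : ∀ f, ‖K.adjoint f - Y₀.starProjection (K.adjoint f)‖ ≤ d * ‖f‖)
    {G : Submodule ℝ H} {m : ℝ} (hm : 0 ≤ m) (hsurj : ∀ f ∈ G, ∃ g ∈ G, K.adjoint (K g) = f)
    (hG : ∀ g ∈ G, ‖g‖ ≤ m * ‖K g‖) (p : ℕ) :
    (∀ f ∈ G, ‖K f - (subspaceX K X₀ Y₀ p).starProjection (K f)‖ ≤ d * (d * m) ^ p * ‖f‖) ∧
      (∀ g ∈ G, ‖K.adjoint (K g) - (subspaceY K X₀ Y₀ p).starProjection (K.adjoint (K g))‖ ≤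
        d * (d * m) ^ p * ‖K g‖) ∧
      ∀ f ∈ G, ‖f - (subspaceY K X₀ Y₀ p).starProjection f‖ ≤ (d * m) ^ (p + 1) * ‖f‖ := by
  -- From `‖K g‖² = (K* K g, g) ≤ ‖K* K g‖ m ‖K g‖`, divided by `‖K g‖`.
  have hKG (g : H) (hg : g ∈ G) : ‖K g‖ ≤ m * ‖K.adjoint (K g)‖ := by
    have h1 : ‖K g‖ ^ 2 = inner ℝ (K.adjoint (K g)) g := by
      rw [ContinuousLinearMap.adjoint_inner_left, real_inner_self_eq_norm_sq]
    have h2 := (real_inner_le_norm (K.adjoint (K g)) g).trans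
      (mul_le_mul_of_nonneg_left (hG g hg) (norm_nonneg _))
    rw [← h1] at h2
    by_contra! hlt
    have h3 : 0 < ‖K g‖ := lt_of_le_of_lt (by positivity) hlt
    nlinarith
  have hthird (q : ℕ)
      (h : ∀ g ∈ G, ‖K.adjoint (K g) - (subspaceY K X₀ Y₀ q).starProjection (K.adjoint (K g))‖ ≤
        d * (d * m) ^ q * ‖K g‖) (f : H) (hf : f ∈ G) :
      ‖f - (subspaceY K X₀ Y₀ q).starProjection f‖ ≤ (d * m) ^ (q + 1) * ‖f‖ := by
    obtain ⟨g, hg, rfl⟩ := hsurj f hf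
    calc _ ≤ d * (d * m) ^ q * ‖K g‖ := h g hg
      _ ≤ d * (d * m) ^ q * (m * ‖K.adjoint (K g)‖) := by gcongr; exact hKG g hg
      _ = _ := by ring
  induction p with
  | zero =>
    have h2 : ∀ g ∈ G, ‖K.adjoint (K g) - (subspaceY K X₀ Y₀ 0).starProjection
        (K.adjoint (K g))‖ ≤ d * (d * m) ^ 0 * ‖K g‖ := fun g _ => by
      rw [pow_zero, mul_one]; exact hY (K g)
    exact ⟨fun f _ => by rw [pow_zero, mul_one]; exact hX f, h2, hthird 0 h2⟩
  | succ p ih =>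
    have hall := norm_sub_starProjection_subspacePair_le hd hX hY p
    have h2 : ∀ g ∈ G, ‖K.adjoint (K g) - (subspaceY K X₀ Y₀ (p + 1)).starProjection
        (K.adjoint (K g))‖ ≤ d * (d * m) ^ (p + 1) * ‖K g‖ := fun g hg => by
      calc _ ≤ d * ‖K g - (subspaceX K X₀ Y₀ p).starProjection (K g)‖ :=
            norm_adjoint_sub_starProjection_map_le hall.1 (K g)
        _ ≤ d * (d * (d * m) ^ p * (m * ‖K g‖)) := by
            gcongr
            exact (ih.1 g hg).trans (by gcongr; exact hG g hg)
        _ = _ := by ring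
    refine ⟨fun f hf => ?_, h2, hthird _ h2⟩
    calc _ ≤ d * ‖f - (subspaceY K X₀ Y₀ p).starProjection f‖ :=
          norm_sub_starProjection_map_le hall.2 f
      _ ≤ d * ((d * m) ^ (p + 1) * ‖f‖) := by gcongr; exact ih.2.2 f hf
      _ = _ := by ring

/-- In the expansion of `‖K f - K r‖²` the cross term equals `((I - P) K* K f, r)`, because `r` is
orthogonal to the range of `P`. Both factors are small, which produces the square of `d * m`. -/
theorem norm_sq_map_starProjection_subspaceY_ge {d : ℝ} (hd : 0 ≤ d)
    (hX : ∀ f, ‖K f - X₀.starProjection (K f)‖ ≤ d * ‖f‖)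
    (hY : ∀ f, ‖K.adjoint f - Y₀.starProjection (K.adjoint f)‖ ≤ d * ‖f‖)
    {G : Submodule ℝ H} {m : ℝ} (hm : 0 ≤ m) (hsurj : ∀ f ∈ G, ∃ g ∈ G, K.adjoint (K g) = f)
    (hG : ∀ g ∈ G, ‖g‖ ≤ m * ‖K g‖) (p : ℕ) {f : H} (hf : f ∈ G) :
    (1 - 2 * ((d * m) ^ 2) ^ (p + 1)) * ‖K f‖ ^ 2 ≤
      ‖K ((subspaceY K X₀ Y₀ p).starProjection f)‖ ^ 2 := by
  obtain ⟨-, h2, h3⟩ := norm_sub_starProjection_subspacePair_le_pow hd hX hY hm hsurj hG p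
  set V := subspaceY K X₀ Y₀ p
  set r := f - V.starProjection f with hr
  have hro : r ∈ Vᗮ := Submodule.sub_starProjection_mem_orthogonal f
  have hKP : K (V.starProjection f) = K f - K r := by rw [← map_sub, hr, sub_sub_cancel]
  have hinner : inner ℝ (K f) (K r) =
      inner ℝ (K.adjoint (K f) - V.starProjection (K.adjoint (K f))) r := by
    rw [inner_sub_left, (Submodule.mem_orthogonal _ _).1 hro _
      (Submodule.starProjection_apply_mem _ _), sub_zero, ContinuousLinearMap.adjoint_inner_left]
  have hbound : inner ℝ (K f) (K r) ≤ ((d * m) ^ 2) ^ (p + 1) * ‖K f‖ ^ 2 := by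
    rw [hinner]
    calc _ ≤ _ := real_inner_le_norm _ _
      _ ≤ (d * (d * m) ^ p * ‖K f‖) * ((d * m) ^ (p + 1) * (m * ‖K f‖)) := by
          gcongr
          · exact h2 f hf
          · exact (h3 f hf).trans (by gcongr; exact hG f hf)
      _ = _ := by ring
  rw [hKP, norm_sub_sq_real]
  nlinarith [sq_nonneg ‖K r‖]

/-- Upper bound for the Ritz values on `Y_p`, and their existence. -/
theorem exists_isNthRitzValue_subspaceY_and_le (hK : IsCompactOperator K)
    (hY₀ : Y₀ ≤ (LinearMap.ker K.toLinearMap)ᗮ) {d : ℝ} (hd : 0 ≤ d)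
    (hX : ∀ f, ‖K f - X₀.starProjection (K f)‖ ≤ d * ‖f‖)
    (hY : ∀ f, ‖K.adjoint f - Y₀.starProjection (K.adjoint f)‖ ≤ d * ‖f‖)
    {G : Submodule ℝ H} {M : ℝ} (hM : 0 ≤ M) (hsurj : ∀ f ∈ G, ∃ g ∈ G, K.adjoint (K g) = f)
    (hG : ∀ g ∈ G, ‖g‖ ^ 2 ≤ M * ‖K g‖ ^ 2) {l : ℕ} (hl : 1 ≤ l)
    (hGl : (l : Cardinal) ≤ Module.rank ℝ G) (p : ℕ) (hp : 2 * (d ^ 2 * M) ^ (p + 1) < 1) :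
    (∃ ν, IsNthRitzValue K (subspaceY K X₀ Y₀ p) l ν) ∧
      ∀ ν, IsNthRitzValue K (subspaceY K X₀ Y₀ p) l ν →
        ν ≤ M / (1 - 2 * (d ^ 2 * M) ^ (p + 1)) := by
  set V := subspaceY K X₀ Y₀ p
  have hVker : V ≤ (LinearMap.ker K.toLinearMap)ᗮ := subspaceY_le_orthogonal_ker hY₀ p
  have hG' (g : H) (hg : g ∈ G) : ‖g‖ ≤ √M * ‖K g‖ := by
    refine le_of_sq_le_sq ?_ (by positivity)
    rw [mul_pow, Real.sq_sqrt hM]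
    exact hG g hg
  have hlow (f : H) (hf : f ∈ G) :
      (1 - 2 * (d ^ 2 * M) ^ (p + 1)) * ‖K f‖ ^ 2 ≤ ‖K (V.starProjection f)‖ ^ 2 := by
    have := norm_sq_map_starProjection_subspaceY_ge hd hX hY (Real.sqrt_nonneg M) hsurj hG' p hf
    rwa [mul_pow, Real.sq_sqrt hM] at this
  have hc : 0 < 1 - 2 * (d ^ 2 * M) ^ (p + 1) := by linarith
  set W := G.map V.starProjection.toLinearMap with hW
  have hWV : W ≤ V := by
    rintro _ ⟨f, -, rfl⟩
    exact Submodule.starProjection_apply_mem V f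
  -- The trial space keeps the dimension of `G`: if `P f = 0`, the lower bound on `‖K P f‖` forces
  -- `K f = 0`, and then `‖f‖² ≤ M ‖K f‖²` forces `f = 0`.
  have hinj : Function.Injective (V.starProjection.toLinearMap.domRestrict G) := by
    rw [injective_iff_map_eq_zero]
    intro f hf
    have hf0 : V.starProjection f = 0 := hf
    have h1 := hlow f f.2
    have h2 := hG f f.2
    rw [hf0, map_zero, norm_zero] at h1
    have h3 : ‖K f‖ ^ 2 ≤ 0 := by
      by_contra! h
      nlinarith [mul_pos hc h]
    have h4 : ‖(f : H)‖ ^ 2 ≤ 0 := by nlinarith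
    exact Subtype.ext (norm_eq_zero.1 (pow_eq_zero_iff two_ne_zero |>.1
      (le_antisymm h4 (sq_nonneg _))))
  have hWl : (l : Cardinal) ≤ Module.rank ℝ W := by
    rw [hW, ← LinearMap.range_domRestrict, ← (LinearEquiv.ofInjective _ hinj).rank_eq]
    exact hGl
  refine ⟨exists_isNthRitzValue hK (fun g hg => eq_zero_of_mem_orthogonal_ker (hVker hg)) hl
    (hWl.trans (Submodule.rank_mono hWV)), fun ν hν =>
    hν.le_of_trial_subspace hK V.closed_of_finiteDimensional hWV hWl ?_⟩
  rintro _ ⟨f, hf, rfl⟩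
  change ‖V.starProjection f‖ ^ 2 ≤ _ * ‖K (V.starProjection f)‖ ^ 2
  calc ‖V.starProjection f‖ ^ 2 ≤ ‖f‖ ^ 2 := by
        gcongr
        exact V.norm_starProjection_apply_le f
    _ ≤ M * ‖K f‖ ^ 2 := hG f hf
    _ ≤ M * (‖K (V.starProjection f)‖ ^ 2 / (1 - 2 * (d ^ 2 * M) ^ (p + 1))) := by
        gcongr
        rw [le_div_iff₀ hc, mul_comm]
        exact hlow f hf
    _ = _ := by ring

end Approximation

/-! ### Optimal subspaces compared with spans of singular vectors. -/

noncomputable section Width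

variable {H : Type*} [NormedAddCommGroup H] [InnerProductSpace ℝ H]

theorem IsOptimalSubspace.finiteDimensional {n : ℕ} {A : Set H} {X : Submodule ℝ H}
    (h : IsOptimalSubspace n A X) : FiniteDimensional ℝ X := h.1

theorem IsOptimalSubspace.norm_sub_starProjection_le {n : ℕ} {L : H →L[ℝ] H} {X F : Submodule ℝ H}
    [FiniteDimensional ℝ X] [FiniteDimensional ℝ F]
    (h : IsOptimalSubspace n (L '' Metric.closedBall 0 1) X) (hF : Module.finrank ℝ F = n)
    {d : ℝ} (hd : 0 ≤ d) (hLF : ∀ f, ‖L f - F.starProjection (L f)‖ ≤ d * ‖f‖) (f : H) :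
    ‖L f - X.starProjection (L f)‖ ≤ d * ‖f‖ := by
  obtain ⟨_, -, h2⟩ := h
  refine (distToSubspace_image_closedBall_le_iff hd).1 ?_ f
  refine h2.symm.le.trans (le_trans ?_ ((distToSubspace_image_closedBall_le_iff hd).2 hLF))
  exact iInf₂_le_of_le F inferInstance (iInf_le _ hF)

variable [CompleteSpace H] {K : H →L[ℝ] H}

/-- The range of `K*` lies in `(ker K)ᗮ`, so the residual of the weak equation is an admissible test
vector and a Ritz vector satisfies `K* K (κ f) = f` exactly. -/
theorem exists_adjoint_map_eq_of_mem_ritzSpan {S : Set ℝ} {f : H}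
    (hf : f ∈ ritzSpan K (LinearMap.ker K.toLinearMap)ᗮ S) :
    ∃ g ∈ ritzSpan K (LinearMap.ker K.toLinearMap)ᗮ S, K.adjoint (K g) = f := by
  induction hf using Submodule.iSup_induction' with
  | mem κ f hf =>
    refine ⟨(κ : ℝ) • f, Submodule.smul_mem _ _ (ritzEigenspace_le_ritzSpan κ.2 hf), ?_⟩
    have hmem (u : H) : K.adjoint u ∈ (LinearMap.ker K.toLinearMap)ᗮ := by
      refine (Submodule.mem_orthogonal _ _).2 fun v hv => ?_
      rw [ContinuousLinearMap.adjoint_inner_right, show K v = 0 from hv, inner_zero_left]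
    set w := K.adjoint (K ((κ : ℝ) • f)) - f with hw
    have hwY : w ∈ (LinearMap.ker K.toLinearMap)ᗮ := Submodule.sub_mem _ (hmem _) hf.1
    rw [← sub_eq_zero, ← hw, ← inner_self_eq_zero (𝕜 := ℝ)]
    nth_rewrite 1 [hw]
    rw [inner_sub_left, ContinuousLinearMap.adjoint_inner_left, map_smul, real_inner_smul_left,
      hf.2 w hwY, sub_self]
  | zero => exact ⟨0, Submodule.zero_mem _, by simp⟩
  | add x y _ _ hx hy =>
    obtain ⟨g, hg, rfl⟩ := hx
    obtain ⟨h, hh, rfl⟩ := hy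
    exact ⟨g + h, Submodule.add_mem _ hg hh, by simp⟩

/-- Optimal subspaces for the images of the unit ball under `K` and `K*` approximate as well as
the first `n` singular vectors. -/
theorem norm_sub_starProjection_le_of_isOptimalSubspace (hK : IsCompactOperator K) {n : ℕ}
    {X₀ Y₀ : Submodule ℝ H} [FiniteDimensional ℝ X₀] [FiniteDimensional ℝ Y₀]
    (hX₀ : IsOptimalSubspace n (classA K 1) X₀) (hY₀ : IsOptimalSubspace n (classAStar K 1) Y₀)
    {ν : ℝ} (hν : 0 < ν)
    (hrank : Module.rank ℝ (ritzSpan K (LinearMap.ker K.toLinearMap)ᗮ (Iio ν)) = n) :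
    (∀ f, ‖K f - X₀.starProjection (K f)‖ ≤ √(ν⁻¹) * ‖f‖) ∧
      ∀ f, ‖K.adjoint f - Y₀.starProjection (K.adjoint f)‖ ≤ √(ν⁻¹) * ‖f‖ := by
  set N := LinearMap.ker K.toLinearMap with hN
  have hNc : CompleteSpace N := K.isClosed_ker.completeSpace_coe
  set F := ritzSpan K Nᗮ (Iio ν) with hF
  have hFN : F ≤ Nᗮ := ritzSpan_le _
  have : FiniteDimensional ℝ F :=
    Module.rank_lt_aleph0_iff.1 (hrank ▸ Cardinal.natCast_lt_aleph0)
  have hfin : Module.finrank ℝ F = n := Module.finrank_eq_of_rank_eq hrank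
  have hinj : Function.Injective (K.toLinearMap.domRestrict F) := by
    rw [injective_iff_map_eq_zero]
    exact fun f hf => Subtype.ext (eq_zero_of_mem_orthogonal_ker (hFN f.2) hf)
  -- The width ranges over subspaces of dimension exactly `n`, so `K(F)` must not lose dimension.
  have hfin' : Module.finrank ℝ (F.map K.toLinearMap) = n := by
    rw [← LinearMap.range_domRestrict, ← (LinearEquiv.ofInjective _ hinj).finrank_eq, hfin]
  -- The min-max bound applies only inside `(ker K)ᗮ`. Removing the kernel component of `r` changes
  -- neither `K r` nor the orthogonality to `F`, and does not increase the norm.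
  have hbound (r : H) (hr : r ∈ Fᗮ) : ‖K r‖ ≤ √(ν⁻¹) * ‖r‖ := by
    set s := r - N.starProjection r with hs
    have hsN : s ∈ Nᗮ := Submodule.sub_starProjection_mem_orthogonal r
    have hmem : N.starProjection r ∈ N := Submodule.starProjection_apply_mem N r
    have hKs : K s = K r := by
      rw [hs, map_sub, show K (N.starProjection r) = 0 from hmem, sub_zero]
    have hsF : s ∈ Fᗮ := Submodule.sub_mem _ hr
      (Submodule.orthogonal_le hFN (Submodule.le_orthogonal_orthogonal N hmem))
    have h1 := mul_norm_sq_le_of_mem_ritzSpan_Iio_orthogonal hK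
      (Submodule.isClosed_orthogonal N) hsN hsF
    have h2 : ‖s‖ ≤ ‖r‖ := norm_sub_starProjection_le_norm N r
    rw [hKs] at h1
    refine le_of_sq_le_sq ?_ (by positivity)
    rw [mul_pow, Real.sq_sqrt (inv_nonneg.2 hν.le), ← div_eq_inv_mul, le_div_iff₀ hν, mul_comm]
    exact h1.trans (by gcongr)
  -- With `r = (I - P_F) K* f`, `‖r‖² = (f, K r)`, and the bound on `Fᗮ` applies to `K r`.
  have hFstar : ∀ f, ‖K.adjoint f - F.starProjection (K.adjoint f)‖ ≤ √(ν⁻¹) * ‖f‖ := by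
    intro f
    set r := K.adjoint f - F.starProjection (K.adjoint f) with hr
    have hrF : r ∈ Fᗮ := Submodule.sub_starProjection_mem_orthogonal _
    have h1 : ‖r‖ ^ 2 = inner ℝ f (K r) := by
      rw [← real_inner_self_eq_norm_sq]
      nth_rewrite 1 [hr]
      rw [inner_sub_left, (Submodule.mem_orthogonal _ _).1 hrF _
        (Submodule.starProjection_apply_mem _ _), sub_zero, ContinuousLinearMap.adjoint_inner_left]
    have h2 := (real_inner_le_norm f (K r)).trans
      (mul_le_mul_of_nonneg_left (hbound r hrF) (norm_nonneg f))
    rw [← h1] at h2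
    by_contra! hlt
    have h3 : 0 < ‖r‖ := lt_of_le_of_lt (by positivity) hlt
    nlinarith
  refine ⟨hX₀.norm_sub_starProjection_le hfin' (Real.sqrt_nonneg _) fun f => ?_,
    hY₀.norm_sub_starProjection_le hfin (Real.sqrt_nonneg _) hFstar⟩
  exact (norm_sub_starProjection_map_le hFstar f).trans
    (mul_le_mul_of_nonneg_left (norm_sub_starProjection_le_norm F f) (Real.sqrt_nonneg _))

end Width

/-! ### The two-sided eigenvalue estimate. -/

theorem mainTheorem7
    (a b : ℝ) (hab : a < b)
    (k : ℝ → ℝ → ℝ) (hk : SquareIntegrableKernel a b k)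
    (K : L2 a b →L[ℝ] L2 a b) (hK : K = integralOperator hk)
    (hKderiv : DerivInvertsOperator K)
    (n : ℕ) (X₀ Y₀ : Submodule ℝ (L2 a b))
    (hX₀ : ∀ x ∈ X₀, ∀ v, K.adjoint v = 0 → inner ℝ x v = 0)
    (hY₀ : ∀ y ∈ Y₀, ∀ v, K v = 0 → inner ℝ y v = 0)
    (hX₀opt : IsOptimalSubspace n (classA K 1) X₀)
    (hY₀opt : IsOptimalSubspace n (classAStar K 1) Y₀)
    (μ : ℕ → ℝ)
    (hμ : ∀ l, 1 ≤ l → l ≤ n + 1 → IsNthEigenvalue (LinearMap.range K.toLinearMap) l (μ l))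
    (hgap : μ n < μ (n + 1))
    (l : ℕ) (hl : 1 ≤ l) (hln : l ≤ n) (p : ℕ)
    (hp : √(l : ℝ) * (μ l / μ 1) * (μ l / μ (n + 1)) ^ p < 1 / 2) :
    (∃ ν, IsNthEigenvalue (subspaceX K X₀ Y₀ p) l ν) ∧
      ∀ ν, IsNthEigenvalue (subspaceX K X₀ Y₀ p) l ν →
        μ l ≤ ν ∧
          ν ≤ μ l / (1 - 2 * √(l : ℝ) * (μ l / μ 1) * (μ l / μ (n + 1)) ^ p) := by
  have hKc : IsCompactOperator K := hK ▸ isCompactOperator_integralOperator hk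
  have hXfin := hX₀opt.finiteDimensional
  have hYfin := hY₀opt.finiteDimensional
  have hritz (m : ℕ) (h1 : 1 ≤ m) (h2 : m ≤ n + 1) :
      IsNthRitzValue K (LinearMap.ker K.toLinearMap)ᗮ m (μ m) := by
    have h := hμ m h1 h2
    rwa [range_eq_map_orthogonal_ker, isNthEigenvalue_map_iff hKderiv le_rfl] at h
  have h1 := hritz 1 le_rfl (by omega)
  have hL := hritz l hl (by omega)
  have hN := hritz n (hl.trans hln) (by omega)
  have hN1 := hritz (n + 1) (by omega) le_rfl
  have hμ1 := h1.pos
  have hμl := hL.pos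
  have hμn1 := hN1.pos
  have h1l : μ 1 ≤ μ l := h1.le_of_le hL hl
  have hfac : 1 ≤ √(l : ℝ) * (μ l / μ 1) :=
    one_le_mul_of_one_le_of_one_le (Real.one_le_sqrt.2 (by exact_mod_cast hl))
      ((one_le_div hμ1).2 h1l)
  have hθ : 0 < μ l / μ (n + 1) := by positivity
  cases p with
  -- Vacuous: `√l μ_l / μ_1 ≥ 1` contradicts the assumed bound `1 / 2`.
  | zero => rw [pow_zero, mul_one] at hp; linarith
  | succ q =>
    set θ := (μ l / μ (n + 1)) ^ (q + 1) with hθdef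
    have hθpos : 0 < θ := pow_pos hθ _
    have hθle : θ ≤ √(l : ℝ) * (μ l / μ 1) * θ := le_mul_of_one_le_left hθpos.le hfac
    have hYker : Y₀ ≤ (LinearMap.ker K.toLinearMap)ᗮ := fun y hy =>
      (Submodule.mem_orthogonal' _ _).2 fun v hv => hY₀ y hy v hv
    -- The strict gap places the first `n` eigenvalues below `μ (n + 1)`; the definition of the `(n
    -- + 1)`-st eigenvalue allows no more.
    have hrank : Module.rank ℝ (ritzSpan K (LinearMap.ker K.toLinearMap)ᗮ (Iio (μ (n + 1)))) =
        n := by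
      refine le_antisymm ?_ (hN.2.trans (Submodule.rank_mono (ritzSpan_mono fun x hx =>
        lt_of_le_of_lt hx hgap)))
      have := hN1.1
      rw [Nat.cast_succ, ← Cardinal.succ_natCast] at this
      exact Order.lt_succ_iff.1 this
    obtain ⟨hX, hY⟩ := norm_sub_starProjection_le_of_isOptimalSubspace hKc hX₀opt hY₀opt hμn1 hrank
    have hρ : √((μ (n + 1))⁻¹) ^ 2 * μ l = μ l / μ (n + 1) := by
      rw [Real.sq_sqrt (inv_nonneg.2 hμn1.le), inv_mul_eq_div]
    obtain ⟨hex, hle⟩ := exists_isNthRitzValue_subspaceY_and_le hKc hYker (Real.sqrt_nonneg _) hX hY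
      hμl.le (fun f hf => exists_adjoint_map_eq_of_mem_ritzSpan hf)
      (fun g hg => norm_sq_le_of_mem_ritzSpan_Iic hg) hl hL.2 q (by rw [hρ]; linarith)
    rw [hρ, ← hθdef] at hle
    have hYq := subspaceY_le_orthogonal_ker (X₀ := X₀) hYker q
    -- `X_{q+1} = K(Y_q)`, so the Ritz space has index `p - 1`, and the exponent `q + 1` of the
    -- error bound on `Y_q` is `p`.
    have hiff (ν : ℝ) : IsNthEigenvalue (subspaceX K X₀ Y₀ (q + 1)) l ν ↔
        IsNthRitzValue K (subspaceY K X₀ Y₀ q) l ν := isNthEigenvalue_map_iff hKderiv hYq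
    simp only [hiff]
    refine ⟨hex, fun ν hν => ⟨hL.le_of_subspace_le hKc (Submodule.isClosed_orthogonal _) hYq hν,
      (hle ν hν).trans ?_⟩⟩
    -- The bound obtained has denominator `1 - 2 θ`; by `hθle` the stated denominator is no larger,
    -- and by `hp` it is positive.
    refine div_le_div_of_nonneg_left hμl.le ?_ ?_
    · linarith
    · linarith
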